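/- Let $d\ge 1$ and let $f\in L^2(\mathbb{R}^d)$ be complex-valued, with ($L^2$-)Fourier transform $\widehat f$ normalised by $\widehat f(y)=\int_{\mathbb{R}^d} f(t)e^{-2\pi i\langle t,y\rangle}\,dt$. Let $a,b>0$ with $ab=1$, and let $M,N$ be real numbers with $\min\{M,N\}=1$. Suppose that for some $j\in\{1,\dots,d\}$ $$\int_{\mathbb{R}^d}|f(x)|\,\frac{e^{\pi a|x_j|^2}}{(1+|x_j|)^{M}}\,dx<+\infty\qquad\text{and}\qquad \int_{\mathbb{R}^d}|\widehat f(y)|\,\frac{e^{\pi b|y_j|^2}}{(1+|y_j|)^{N}}\,dy<+\infty .$$ Then $f$ is identically $0$ (that is, $f=0$ almost everywhere). -/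

import Mathlib

open MeasureTheory
open scoped FourierTransform

/-! Fix all frequency coordinates but the `j`-th. As a function of the remaining one, the Fourier
integral of `f` extends to an entire function. Completing the square with `a * b = 1` bounds it by a
power of `1 + |z.im|` times `exp (π b z.im ^ 2)`. Multiplying by `exp (π b z ^ 2)` gives `H`, of
Gaussian growth in `z.re` only. Its restrictions to the two axes are integrable against polynomial
weights: on the real axis by the hypothesis on the transform, on the imaginary axis by Tonelli and
the one on `f`.

The primitive of `H` is then polynomially bounded on the real axis, and a Phragmén–Lindelöf argument
in each quadrant (`norm_le_of_quadrant`) makes it a polynomial. So `H` is a polynomial, and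
integrability against `1 / (1 + |s|)` on one axis forces `H = 0` (`eq_zero_of_integrable_on_axes`).
Hence the transform vanishes on almost every line, and Plancherel gives `f = 0`. -/

/-! ### Polynomials: growth and integrability -/

/-- An entire function of polynomial growth is a polynomial. -/
theorem exists_polynomial_of_norm_le {f : ℂ → ℂ} (hf : Differentiable ℂ f) {C : ℝ} {k : ℕ}
    (h : ∀ z, ‖f z‖ ≤ C * (1 + ‖z‖) ^ k) : ∃ P : Polynomial ℂ, ∀ z, f z = P.eval z := by
  induction k generalizing f C with
  | zero =>
    refine ⟨Polynomial.C (f 0), fun z => ?_⟩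
    rw [Polynomial.eval_C]
    refine hf.apply_eq_apply_of_bounded ?_ z 0
    refine isBounded_iff_forall_norm_le.2 ⟨C, ?_⟩
    rintro _ ⟨w, rfl⟩
    simpa using h w
  | succ k ih =>
    have hC : 0 ≤ C := by simpa using (norm_nonneg _).trans (h 0)
    have hd : Differentiable ℂ (dslope f 0) := by
      rw [← differentiableOn_univ] at hf ⊢
      exact (Complex.differentiableOn_dslope Filter.univ_mem).2 hf
    obtain ⟨D, hD⟩ := (isCompact_closedBall (0 : ℂ) 1).exists_bound_of_continuousOn
      hd.continuous.continuousOn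
    have hD0 : 0 ≤ D := (norm_nonneg _).trans (hD 0 (by simp))
    have key : ∀ z, z * dslope f 0 z = f z - f 0 := fun z => by
      simpa using sub_smul_dslope f 0 z
    -- `D` serves the unit disc; outside it, `1 + ‖z‖ ≤ 2 * ‖z‖` costs the factor 4.
    obtain ⟨P, hP⟩ := ih hd (C := D + 4 * C) fun z => by
      have h1 : 1 ≤ (1 + ‖z‖) ^ k := one_le_pow₀ (by linarith [norm_nonneg z])
      rcases le_or_gt ‖z‖ 1 with hz | hz
      · have := hD z (by simpa using hz)
        nlinarith
      · have h2 : ‖z‖ * ‖dslope f 0 z‖ ≤ C * (1 + ‖z‖) ^ (k + 1) + C := by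
          rw [← norm_mul, key]
          exact (norm_sub_le _ _).trans (add_le_add (h z) (by simpa using h 0))
        have h3 : C * (1 + ‖z‖) ^ (k + 1) + C ≤ ‖z‖ * (4 * C * (1 + ‖z‖) ^ k) := by
          have : (1 + ‖z‖) ^ (k + 1) ≤ 2 * ‖z‖ * (1 + ‖z‖) ^ k := by
            rw [pow_succ']; gcongr; linarith
          have h4 : 1 ≤ 2 * ‖z‖ * (1 + ‖z‖) ^ k := by nlinarith
          nlinarith
        have h5 : ‖dslope f 0 z‖ ≤ 4 * C * (1 + ‖z‖) ^ k :=
          le_of_mul_le_mul_left (h2.trans h3) (by linarith)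
        nlinarith
    refine ⟨Polynomial.C (f 0) + Polynomial.X * P, fun z => ?_⟩
    have := key z
    rw [hP] at this
    simp [this]

/-- A nonzero polynomial stays away from zero near infinity, so `1 / s` would be integrable there.
-/
theorem Polynomial.eq_zero_of_integrable_norm_div {Q : Polynomial ℂ}
    (h : Integrable fun s : ℝ => ‖Q.eval (s : ℂ)‖ / (1 + |s|)) : Q = 0 := by
  by_contra hQ
  obtain ⟨c, hc, hev⟩ : ∃ c > 0, ∀ᶠ s : ℝ in Filter.atTop, c ≤ ‖Q.eval (s : ℂ)‖ := by
    rcases le_or_gt Q.degree 0 with hd | hd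
    · rw [Polynomial.eq_C_of_degree_le_zero hd] at hQ ⊢
      refine ⟨‖Q.coeff 0‖, norm_pos_iff.2 fun h0 => hQ (by simp [h0]), ?_⟩
      simp
    · refine ⟨1, one_pos, ?_⟩
      have := Q.tendsto_norm_atTop hd (l := Filter.atTop) (z := fun s : ℝ => (s : ℂ)) (by
        simpa using Filter.tendsto_abs_atTop_atTop)
      exact this.eventually_ge_atTop 1
  obtain ⟨R, hR⟩ := (hev.and (Filter.eventually_ge_atTop 1)).exists_forall_of_atTop
  refine not_integrableOn_Ioi_inv (a := R) ?_
  refine Integrable.mono' ((h.integrableOn (s := Set.Ioi R)).const_mul (2 / c))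
    (by fun_prop) ?_
  filter_upwards [ae_restrict_mem measurableSet_Ioi] with s hs
  obtain ⟨h1, h2⟩ := hR s (le_of_lt hs)
  have hs0 : 0 < s := by linarith
  rw [norm_inv, Real.norm_eq_abs, abs_of_pos hs0]
  rw [div_mul_div_comm, inv_eq_one_div, div_le_div_iff₀ hs0 (by positivity)]
  nlinarith

/-! ### Phragmén–Lindelöf at the critical order -/

open Complex in
/-- Phragmén–Lindelöf in the first quadrant at the critical order, when the type tends to zero
at the imaginary axis. -/
theorem norm_le_of_quadrant {G : ℂ → ℂ} {B β : ℝ} (hβ : 0 ≤ β)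
    (hG : ∀ z : ℂ, 0 ≤ z.re → DifferentiableAt ℂ G z)
    (hgr : ∀ z : ℂ, 0 ≤ z.re → ‖G z‖ ≤ B * Real.exp (β * z.re ^ 2))
    (hre : ∀ s : ℝ, 0 ≤ s → ‖G s‖ ≤ B) {z : ℂ} (hz : 0 ≤ z.re) (hz' : 0 ≤ z.im) :
    ‖G z‖ ≤ B := by
  have hB : 0 ≤ B := (norm_nonneg _).trans (hre 0 le_rfl)
  have hnorm : ∀ (δ : ℝ) (w : ℂ), ‖cexp (I * δ * w ^ 2)‖ = Real.exp (-2 * δ * w.re * w.im) := by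
    intro δ w
    rw [Complex.norm_exp]
    congr 1
    simp [pow_two]
    ring
  -- The factor has modulus `exp (-2 δ x y)`. Past a ray of angle `θ` close to `π / 2` it beats `exp
  -- (β x ^ 2)` outright; below that ray the sector is narrower than `π / 2`, so order two is
  -- subcritical. Finally `δ → 0`.
  have main : ∀ δ : ℝ, 0 < δ → ‖G z * cexp (I * δ * z ^ 2)‖ ≤ B := by
    intro δ hδ
    rcases eq_or_ne z 0 with rfl | hz0
    · simpa using hre 0 le_rfl
    obtain ⟨θ, hθ0, hθ1, hθ⟩ : ∃ θ : ℝ, 0 < θ ∧ θ < Real.pi / 2 ∧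
        β * Real.cos θ ≤ 2 * δ * Real.sin θ := by
      have hc : Filter.Tendsto (fun t : ℝ => 2 * δ * Real.sin t - β * Real.cos t)
          (nhdsWithin (Real.pi / 2) (Set.Iio (Real.pi / 2))) (nhds (2 * δ)) := by
        have : Continuous (fun t : ℝ => 2 * δ * Real.sin t - β * Real.cos t) := by fun_prop
        simpa using (this.tendsto (Real.pi / 2)).mono_left nhdsWithin_le_nhds
      have h1 := hc.eventually (lt_mem_nhds (show (0 : ℝ) < 2 * δ by positivity))
      have h2 : ∀ᶠ t in nhdsWithin (Real.pi / 2) (Set.Iio (Real.pi / 2)),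
          t ∈ Set.Ioo 0 (Real.pi / 2) := Ioo_mem_nhdsLT (by positivity)
      obtain ⟨t, ht, ht'⟩ := (h1.and h2).exists
      exact ⟨t, ht'.1, ht'.2, by linarith⟩
    have hcosθ : 0 < Real.cos θ := Real.cos_pos_of_mem_Ioo ⟨by linarith, hθ1⟩
    have hsinθ : 0 < Real.sin θ := Real.sin_pos_of_pos_of_lt_pi hθ0 (by linarith)
    have upper : ∀ ζ : ℂ, θ ≤ ζ.im → ζ.im ≤ Real.pi / 2 →
        ‖G (cexp ζ) * cexp (I * δ * (cexp ζ) ^ 2)‖ ≤ B := by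
      intro ζ h1 h2
      have hc : 0 ≤ Real.cos ζ.im := Real.cos_nonneg_of_mem_Icc ⟨by linarith, h2⟩
      have hc' : Real.cos ζ.im ≤ Real.cos θ :=
        Real.cos_le_cos_of_nonneg_of_le_pi hθ0.le (by linarith) h1
      have hs' : Real.sin θ ≤ Real.sin ζ.im :=
        Real.sin_le_sin_of_le_of_le_pi_div_two (by linarith) h2 h1
      have hre' : 0 ≤ (cexp ζ).re := by rw [exp_re]; positivity
      rw [norm_mul, hnorm]
      refine (mul_le_mul_of_nonneg_right (hgr _ hre') (Real.exp_nonneg _)).trans ?_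
      rw [mul_assoc, ← Real.exp_add]
      refine mul_le_of_le_one_right hB (Real.exp_le_one_iff.2 ?_)
      rw [exp_re, exp_im]
      have h3 : β * Real.cos ζ.im ≤ 2 * δ * Real.sin ζ.im :=
        (mul_le_mul_of_nonneg_left hc' hβ).trans (hθ.trans (by gcongr))
      have h4 : 0 ≤ Real.exp ζ.re ^ 2 * Real.cos ζ.im := by positivity
      nlinarith
    have lower : ∀ ζ : ℂ, 0 ≤ ζ.im → ζ.im ≤ θ →
        ‖G (cexp ζ) * cexp (I * δ * (cexp ζ) ^ 2)‖ ≤ B := by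
      intro ζ h1 h2
      have hrepos : ∀ w : ℂ, 0 ≤ w.im → w.im ≤ θ → 0 ≤ (cexp w).re := by
        intro w hw hw'
        rw [exp_re]
        exact mul_nonneg (Real.exp_nonneg _)
          (Real.cos_nonneg_of_mem_Icc ⟨by linarith, by linarith⟩)
      -- The exponential turns the strip `0 < im < θ` into the sector; order two is admissible since
      -- `2 < π / θ`.
      refine PhragmenLindelof.horizontal_strip (a := 0) (b := θ)
        (f := fun w => G (cexp w) * cexp (I * δ * (cexp w) ^ 2)) ?_ ?_ ?_ ?_ h1 h2
      · refine DifferentiableOn.diffContOnCl fun w hw => ?_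
        have hcl : closure (im ⁻¹' Set.Ioo 0 θ) ⊆ im ⁻¹' Set.Icc 0 θ :=
          closure_minimal (Set.preimage_mono Set.Ioo_subset_Icc_self)
            (isClosed_Icc.preimage continuous_im)
        have hw' := hcl hw
        have := hG (cexp w) (hrepos w hw'.1 hw'.2)
        refine DifferentiableAt.differentiableWithinAt ?_
        refine DifferentiableAt.mul (DifferentiableAt.comp w this (by fun_prop)) (by fun_prop)
      · refine ⟨2, ?_, β, ?_⟩
        · rw [sub_zero, lt_div_iff₀ hθ0]; linarith
        · refine Asymptotics.IsBigO.of_bound B ?_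
          refine Filter.Eventually.filter_mono inf_le_right ?_
          rw [Filter.eventually_principal]
          intro w hw
          have hr := hrepos w hw.1.le hw.2.le
          have hc : 0 ≤ Real.cos w.im :=
            Real.cos_nonneg_of_mem_Icc ⟨by linarith [hw.1], by linarith [hw.2]⟩
          have hs : 0 ≤ Real.sin w.im :=
            Real.sin_nonneg_of_nonneg_of_le_pi hw.1.le (by linarith [hw.2])
          rw [norm_mul, hnorm, Real.norm_of_nonneg (Real.exp_nonneg _)]
          refine (mul_le_mul_of_nonneg_right (hgr _ hr) (Real.exp_nonneg _)).trans ?_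
          rw [mul_assoc, ← Real.exp_add]
          refine mul_le_mul_of_nonneg_left (Real.exp_le_exp.2 ?_) hB
          rw [exp_re, exp_im]
          have h3 : 0 ≤ δ * (Real.exp w.re * Real.cos w.im) * (Real.exp w.re * Real.sin w.im) := by
            positivity
          have h4 : (Real.exp w.re * Real.cos w.im) ^ 2 ≤ Real.exp (2 * |w.re|) := by
            have : Real.exp w.re * Real.cos w.im ≤ Real.exp |w.re| := by
              refine (mul_le_of_le_one_right (Real.exp_nonneg _) (Real.cos_le_one _)).trans ?_
              exact Real.exp_le_exp.2 (le_abs_self _)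
            calc _ ≤ Real.exp |w.re| ^ 2 := by gcongr
              _ = _ := by rw [← Real.exp_nat_mul]; norm_num
          nlinarith
      · intro w hw
        have : cexp w = (Real.exp w.re : ℝ) := by
          apply Complex.ext <;> simp [exp_re, exp_im, hw]
        rw [norm_mul, hnorm, this]
        simpa using hre _ (Real.exp_nonneg w.re)
      · intro w hw
        exact upper w hw.ge (by linarith)
    have harg0 : 0 ≤ (Complex.log z).im := by
      rw [Complex.log_im]; exact Complex.arg_nonneg_iff.2 hz'
    have harg1 : (Complex.log z).im ≤ Real.pi / 2 := by
      rw [Complex.log_im]; exact Complex.arg_le_pi_div_two_iff.2 (Or.inl hz)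
    rw [← Complex.exp_log hz0]
    rcases le_total (Complex.log z).im θ with h | h
    · exact lower _ harg0 h
    · exact upper _ h harg1
  have lim : Filter.Tendsto (fun δ : ℝ => ‖G z * cexp (I * δ * z ^ 2)‖)
      (nhdsWithin 0 (Set.Ioi 0)) (nhds ‖G z‖) := by
    have : Continuous (fun δ : ℝ => ‖G z * cexp (I * δ * z ^ 2)‖) := by fun_prop
    simpa using (this.tendsto 0).mono_left nhdsWithin_le_nhds
  exact le_of_tendsto lim (eventually_nhdsWithin_of_forall fun δ hδ => main δ hδ)

/-- Dividing by `(1 + z) ^ k`, which has no zero in the closed right half-plane and is comparable to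
`(1 + ‖z‖) ^ k` there, reduces to the bounded case. -/
theorem norm_le_of_quadrant_of_polynomial_growth {K : ℂ → ℂ} (hK : Differentiable ℂ K)
    {A β : ℝ} {k : ℕ} (hβ : 0 ≤ β)
    (hgr : ∀ z : ℂ, ‖K z‖ ≤ A * (1 + ‖z‖) ^ k * Real.exp (β * z.re ^ 2))
    (hre : ∀ s : ℝ, ‖K s‖ ≤ A * (1 + |s|) ^ k) {z : ℂ} (hz : 0 ≤ z.re) (hz' : 0 ≤ z.im) :
    ‖K z‖ ≤ 2 ^ k * A * (1 + ‖z‖) ^ k := by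
  have hA : 0 ≤ A := by simpa using (norm_nonneg _).trans (hre 0)
  have h1 : ∀ w : ℂ, 0 ≤ w.re → (1 + ‖w‖) / 2 ≤ ‖1 + w‖ := fun w hw => by
    have h2 := Complex.abs_re_le_norm (1 + w)
    have h3 : ‖w‖ ≤ ‖1 + w‖ := by
      rw [Complex.norm_def, Complex.norm_def]
      apply Real.sqrt_le_sqrt
      simp [Complex.normSq_apply]
      nlinarith
    simp only [Complex.add_re, Complex.one_re] at h2
    linarith [le_abs_self (1 + w.re)]
  have h0 : ∀ w : ℂ, 0 ≤ w.re → 1 + w ≠ 0 := fun w hw h => by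
    have := congrArg Complex.re h
    simp at this
    linarith
  have hdiv : ∀ (w : ℂ) (D : ℝ), 0 ≤ w.re → ‖K w‖ ≤ A * (1 + ‖w‖) ^ k * D → 0 ≤ D →
      ‖K w / (1 + w) ^ k‖ ≤ 2 ^ k * A * D := by
    intro w D hw hKw hD
    rw [norm_div, norm_pow, div_le_iff₀ (pow_pos (norm_pos_iff.2 (h0 w hw)) k)]
    refine hKw.trans ?_
    have : (1 + ‖w‖) ^ k ≤ 2 ^ k * ‖1 + w‖ ^ k := by
      rw [← mul_pow]
      gcongr
      linarith [h1 w hw]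
    calc _ ≤ A * (2 ^ k * ‖1 + w‖ ^ k) * D := by gcongr
      _ = _ := by ring
  have := norm_le_of_quadrant (G := fun w => K w / (1 + w) ^ k) (B := 2 ^ k * A) hβ
    (fun w hw => (hK w).div (by fun_prop) (pow_ne_zero _ (h0 w hw)))
    (fun w hw => hdiv w _ hw (hgr w) (Real.exp_nonneg _))
    (fun s hs => by simpa using hdiv s 1 (by simpa using hs) (by simpa using hre s) zero_le_one)
    hz hz'
  rw [norm_div, norm_pow, div_le_iff₀ (pow_pos (norm_pos_iff.2 (h0 z hz)) k)] at this
  refine this.trans ?_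
  gcongr
  simpa using norm_add_le (1 : ℂ) z

/-- The hypotheses are invariant under conjugation and `z ↦ -z`, which carry the first quadrant to
the others. -/
theorem norm_le_of_polynomial_growth_on_real {K : ℂ → ℂ} (hK : Differentiable ℂ K)
    {A β : ℝ} {k : ℕ} (hβ : 0 ≤ β)
    (hgr : ∀ z : ℂ, ‖K z‖ ≤ A * (1 + ‖z‖) ^ k * Real.exp (β * z.re ^ 2))
    (hre : ∀ s : ℝ, ‖K s‖ ≤ A * (1 + |s|) ^ k) (z : ℂ) :
    ‖K z‖ ≤ 2 ^ k * A * (1 + ‖z‖) ^ k := by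
  have upper : ∀ K : ℂ → ℂ, Differentiable ℂ K →
      (∀ z : ℂ, ‖K z‖ ≤ A * (1 + ‖z‖) ^ k * Real.exp (β * z.re ^ 2)) →
      (∀ s : ℝ, ‖K s‖ ≤ A * (1 + |s|) ^ k) → ∀ z : ℂ, 0 ≤ z.re →
      ‖K z‖ ≤ 2 ^ k * A * (1 + ‖z‖) ^ k := by
    intro K hK hgr hre z hz
    rcases le_total 0 z.im with hz' | hz'
    · exact norm_le_of_quadrant_of_polynomial_growth hK hβ hgr hre hz hz'
    · have := norm_le_of_quadrant_of_polynomial_growth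
        (K := fun w => (starRingEnd ℂ) (K ((starRingEnd ℂ) w)))
        (fun w => by simpa [Function.comp_def] using (hK ((starRingEnd ℂ) w)).conj_conj) hβ
        (fun w => by simpa using hgr ((starRingEnd ℂ) w))
        (fun s => by simpa using hre s) (z := (starRingEnd ℂ) z) (by simpa using hz)
        (by simpa using hz')
      simpa using this
  rcases le_total 0 z.re with hz | hz
  · exact upper K hK hgr hre z hz
  · have := upper (fun w => K (-w)) (hK.comp differentiable_neg)
      (fun w => by simpa using hgr (-w)) (fun s => by simpa using hre (-s)) (-z) (by simpa using hz)
    simpa using this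

/-! ### Vanishing from integrability on both axes -/

theorem norm_intervalIntegral_le_of_integrable_div {g : ℝ → ℂ} {n : ℕ}
    (hg : Integrable fun s : ℝ => ‖g s‖ / (1 + |s|) ^ n) (s : ℝ) :
    ‖∫ u in (0 : ℝ)..s, g u‖ ≤ (∫ u : ℝ, ‖g u‖ / (1 + |u|) ^ n) * (1 + |s|) ^ n := by
  have hpos : ∀ u : ℝ, 0 ≤ ‖g u‖ / (1 + |u|) ^ n := fun u => by positivity
  have h1 : ‖∫ u in (0 : ℝ)..s, g u‖ ≤
      ∫ u in Set.uIoc 0 s, ‖g u‖ / (1 + |u|) ^ n * (1 + |s|) ^ n := by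
    rw [intervalIntegral.norm_intervalIntegral_eq]
    refine norm_integral_le_of_norm_le (hg.integrableOn.mul_const _) ?_
    filter_upwards [ae_restrict_mem measurableSet_uIoc] with u hu
    have hus : |u| ≤ |s| := by
      simpa using Set.abs_sub_left_of_mem_uIcc (Set.uIoc_subset_uIcc hu)
    rw [div_mul_eq_mul_div, le_div_iff₀ (by positivity)]
    gcongr
  refine h1.trans ?_
  rw [integral_mul_const]
  gcongr
  · exact Filter.Eventually.of_forall hpos
  · exact Measure.restrict_le_self

/-- An entire function whose growth is of critical order two, with integrable polynomially weighted
boundary values on both axes, vanishes if one of the two weights is linear. -/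
theorem eq_zero_of_integrable_on_axes {H : ℂ → ℂ} (hH : Differentiable ℂ H) {C β : ℝ} {m n : ℕ}
    (hβ : 0 ≤ β)
    (hgr : ∀ z : ℂ, ‖H z‖ ≤ C * (1 + |z.im|) ^ m * Real.exp (β * z.re ^ 2))
    (hr : Integrable fun s : ℝ => ‖H s‖ / (1 + |s|) ^ n)
    (hi : Integrable fun t : ℝ => ‖H (t * Complex.I)‖ / (1 + |t|) ^ m)
    (hmn : m = 1 ∨ n = 1) (z : ℂ) : H z = 0 := by
  have hC : 0 ≤ C := by simpa using (norm_nonneg _).trans (hgr 0)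
  -- Passing to a primitive turns the integral bound on the real axis into a pointwise one.
  obtain ⟨K, hK0, hK⟩ := hH.isExactOn_univ.with_val_at 0 0
  replace hK : ∀ w, HasDerivAt K (H w) w := fun w => hK w trivial
  have hKd : Differentiable ℂ K := fun w => (hK w).differentiableAt
  set J := ∫ u : ℝ, ‖H u‖ / (1 + |u|) ^ n
  have hJ0 : 0 ≤ J := integral_nonneg fun u => by positivity
  have hreal : ∀ s : ℝ, ‖K s‖ ≤ J * (1 + |s|) ^ n := by
    intro s
    have : ∫ u in (0 : ℝ)..s, H u = K s - K (0 : ℝ) := by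
      refine intervalIntegral.integral_eq_sub_of_hasDerivAt (f := fun u : ℝ => K u)
        (fun u _ => (hK u).comp_ofReal) ?_
      exact (hH.continuous.comp Complex.continuous_ofReal).intervalIntegrable _ _
    rw [Complex.ofReal_zero, hK0, sub_zero] at this
    rw [← this]
    exact norm_intervalIntegral_le_of_integrable_div (g := fun u : ℝ => H u) hr s
  -- The extra power in `m + 1` comes from integrating `H` along a vertical segment of length
  -- `|w.im|`.
  set k := max n (m + 1)
  have hvert : ∀ w : ℂ, ‖K w - K w.re‖ ≤
      C * (1 + |w.im|) ^ m * Real.exp (β * w.re ^ 2) * |w.im| := by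
    intro w
    have hconv : Convex ℝ {v : ℂ | v.re = w.re ∧ |v.im| ≤ |w.im|} := by
      have : {v : ℂ | v.re = w.re ∧ |v.im| ≤ |w.im|} =
          Complex.reLm ⁻¹' {w.re} ∩ Complex.imLm ⁻¹' Set.Icc (-|w.im|) |w.im| := by
        ext v; simp [abs_le]
      rw [this]
      exact ((convex_singleton _).linear_preimage _).inter ((convex_Icc _ _).linear_preimage _)
    have := hconv.norm_image_sub_le_of_norm_hasDerivWithin_le (f := K) (f' := H)
      (C := C * (1 + |w.im|) ^ m * Real.exp (β * w.re ^ 2)) (x := (w.re : ℂ)) (y := w)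
      (fun v _ => (hK v).hasDerivWithinAt)
      (fun v hv => by
        refine (hgr v).trans ?_
        rw [hv.1]
        have := hv.2
        gcongr C * (1 + ?_) ^ m * _)
      ⟨by simp, by simp⟩ ⟨rfl, le_rfl⟩
    have h2 : ‖w - (w.re : ℂ)‖ = |w.im| := by
      have : w - (w.re : ℂ) = w.im * Complex.I := by
        apply Complex.ext <;> simp
      rw [this]; simp
    rwa [h2] at this
  have hpoly : ∀ w : ℂ, ‖K w‖ ≤ 2 ^ k * (J + C) * (1 + ‖w‖) ^ k := by
    refine norm_le_of_polynomial_growth_on_real hKd hβ (fun w => ?_) (fun s => ?_)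
    · have h1 : ‖K w‖ ≤ ‖K w - K w.re‖ + ‖K w.re‖ := by
        simpa using norm_add_le (K w - K w.re) (K w.re)
      have hE : 1 ≤ Real.exp (β * w.re ^ 2) := Real.one_le_exp (by positivity)
      have h2 : ‖K w.re‖ ≤ J * (1 + ‖w‖) ^ k * Real.exp (β * w.re ^ 2) := by
        refine (hreal w.re).trans ?_
        calc J * (1 + |w.re|) ^ n ≤ J * (1 + ‖w‖) ^ n := by gcongr; exact Complex.abs_re_le_norm w
          _ ≤ J * (1 + ‖w‖) ^ k := by
            gcongr
            · linarith [norm_nonneg w]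
            · exact le_max_left _ _
          _ ≤ _ := le_mul_of_one_le_right (by positivity) hE
      have h3 : ‖K w - K w.re‖ ≤ C * (1 + ‖w‖) ^ k * Real.exp (β * w.re ^ 2) := by
        refine (hvert w).trans ?_
        have hi : |w.im| ≤ ‖w‖ := Complex.abs_im_le_norm w
        calc _ = C * ((1 + |w.im|) ^ m * |w.im|) * Real.exp (β * w.re ^ 2) := by ring
          _ ≤ C * ((1 + ‖w‖) ^ m * (1 + ‖w‖)) * Real.exp (β * w.re ^ 2) := by
            gcongr; linarith
          _ = C * (1 + ‖w‖) ^ (m + 1) * Real.exp (β * w.re ^ 2) := by rw [pow_succ (1 + ‖w‖)]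
          _ ≤ _ := by
            gcongr
            · linarith [norm_nonneg w]
            · exact le_max_right _ _
      calc _ ≤ _ := h1
        _ ≤ _ := add_le_add h3 h2
        _ = _ := by ring
    · refine (hreal s).trans ?_
      gcongr
      · linarith
      · linarith [abs_nonneg s]
      · exact le_max_left _ _
  obtain ⟨P, hP⟩ := exists_polynomial_of_norm_le hKd hpoly
  have hHP : ∀ w, H w = P.derivative.eval w := fun w => by
    have : K = fun w => P.eval w := funext hP
    exact (hK w).unique (this ▸ P.hasDerivAt w)
  rw [hHP]
  rcases hmn with rfl | rfl
  · have h0 : P.derivative.comp (Polynomial.C Complex.I * Polynomial.X) = 0 := by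
      apply Polynomial.eq_zero_of_integrable_norm_div
      simpa only [Polynomial.eval_comp, Polynomial.eval_mul, Polynomial.eval_C, Polynomial.eval_X,
        hHP, pow_one, mul_comm Complex.I] using hi
    have := congrArg (Polynomial.eval (-Complex.I * z)) h0
    have hz : Complex.I * (-Complex.I * z) = z := by
      rw [← mul_assoc]; simp
    simpa only [Polynomial.eval_comp, Polynomial.eval_mul, Polynomial.eval_C, Polynomial.eval_X,
      Polynomial.eval_zero, hz] using this
  · have h0 : P.derivative = 0 := by
      apply Polynomial.eq_zero_of_integrable_norm_div
      simpa [hHP] using hr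
    simp [h0]

/-! ### Gaussian kernel estimates -/

theorem exists_one_add_abs_pow_mul_exp_le {c : ℝ} (hc : 0 < c) (m : ℕ) :
    ∃ D : ℝ, 0 ≤ D ∧ ∀ u : ℝ,
      (1 + |u|) ^ m * Real.exp (-(2 * c) * u ^ 2) ≤ D * Real.exp (-c * u ^ 2) := by
  refine ⟨m.factorial * Real.exp (1 + 1 / (4 * c)), by positivity, fun u => ?_⟩
  have h1 : (1 + |u|) ^ m ≤ m.factorial * Real.exp (1 + |u|) := by
    have := Real.pow_div_factorial_le_exp (1 + |u|) (by positivity) m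
    rwa [div_le_iff₀' (by positivity)] at this
  have h2 : |u| ≤ c * u ^ 2 + 1 / (4 * c) := by
    have h3 : c * u ^ 2 + 1 / (4 * c) - |u| = c * (|u| - 1 / (2 * c)) ^ 2 := by
      rw [← sq_abs u]; field_simp; ring
    have : 0 ≤ c * (|u| - 1 / (2 * c)) ^ 2 := by positivity
    linarith
  calc _ ≤ m.factorial * Real.exp (1 + |u|) * Real.exp (-(2 * c) * u ^ 2) := by gcongr
    _ = m.factorial * Real.exp (1 + |u| + -(2 * c) * u ^ 2) := by rw [mul_assoc, ← Real.exp_add]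
    _ ≤ m.factorial * Real.exp (1 + 1 / (4 * c) + -c * u ^ 2) := by
      gcongr m.factorial * Real.exp ?_
      linarith
    _ = _ := by rw [Real.exp_add, mul_assoc]

/-- Since `a * b = 1`, `2πτt = πat² + πbτ² - πa(t - bτ)²`. Half of the last Gaussian absorbs the
polynomial factor in `t - bτ`; the other half is kept so that one can integrate in `τ`. -/
theorem exists_exp_mul_le_gaussian_weight {a b : ℝ} (ha : 0 < a) (hb : 0 < b) (hab : a * b = 1)
    (m : ℕ) : ∃ D : ℝ, 0 ≤ D ∧ ∀ τ t : ℝ, Real.exp (2 * Real.pi * τ * t) ≤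
      Real.exp (Real.pi * a * |t| ^ 2) / (1 + |t|) ^ m *
        (D * ((1 + |τ|) ^ m * Real.exp (Real.pi * b * τ ^ 2)) *
          Real.exp (-(Real.pi * a / 2) * (t - b * τ) ^ 2)) := by
  obtain ⟨D, hD0, hD⟩ := exists_one_add_abs_pow_mul_exp_le
    (c := Real.pi * a / 2) (by positivity) m
  refine ⟨(1 + b) ^ m * D, by positivity, fun τ t => ?_⟩
  have h1 : 1 + |t| ≤ (1 + b) * (1 + |τ|) * (1 + |t - b * τ|) := by
    have h2 : |t| ≤ |t - b * τ| + b * |τ| := by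
      have := abs_add_le (t - b * τ) (b * τ)
      rwa [sub_add_cancel, abs_mul, abs_of_pos hb] at this
    have h3 := abs_nonneg τ
    have h4 := abs_nonneg (t - b * τ)
    have h5 : 0 ≤ b * |τ| * |t - b * τ| := by positivity
    have h6 : 0 ≤ |τ| * |t - b * τ| := by positivity
    have h7 : 0 ≤ b * |t - b * τ| := by positivity
    nlinarith
  have hexp : Real.exp (2 * Real.pi * τ * t) = Real.exp (Real.pi * a * |t| ^ 2) *
      (Real.exp (Real.pi * b * τ ^ 2) * Real.exp (-(2 * (Real.pi * a / 2)) * (t - b * τ) ^ 2)) := by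
    rw [← Real.exp_add, ← Real.exp_add, sq_abs]
    congr 1
    linear_combination (2 * Real.pi * τ * t - Real.pi * b * τ ^ 2) * (-hab)
  rw [hexp, div_mul_eq_mul_div, le_div_iff₀ (by positivity)]
  calc _ ≤ Real.exp (Real.pi * a * |t| ^ 2) * (Real.exp (Real.pi * b * τ ^ 2) *
        Real.exp (-(2 * (Real.pi * a / 2)) * (t - b * τ) ^ 2)) *
          ((1 + b) * (1 + |τ|) * (1 + |t - b * τ|)) ^ m := by gcongr
    _ = Real.exp (Real.pi * a * |t| ^ 2) * (Real.exp (Real.pi * b * τ ^ 2) *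
        ((1 + b) ^ m * (1 + |τ|) ^ m * ((1 + |t - b * τ|) ^ m *
          Real.exp (-(2 * (Real.pi * a / 2)) * (t - b * τ) ^ 2)))) := by
      rw [mul_pow, mul_pow]; ring
    _ ≤ Real.exp (Real.pi * a * |t| ^ 2) * (Real.exp (Real.pi * b * τ ^ 2) *
        ((1 + b) ^ m * (1 + |τ|) ^ m * (D * Real.exp (-(Real.pi * a / 2) * (t - b * τ) ^ 2)))) := by
      refine mul_le_mul_of_nonneg_left (mul_le_mul_of_nonneg_left
        (mul_le_mul_of_nonneg_left (hD _) ?_) ?_) ?_ <;> positivity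
    _ = _ := by ring

/-! ### The Fourier integral at complex frequencies -/

section LaplaceIntegral

variable {X : Type*} [MeasurableSpace X]

/-- The Fourier transform, at a complex frequency, of the complex measure `φ μ` along `t`. -/
noncomputable def complexFourier (μ : Measure X) (φ : X → ℂ) (t : X → ℝ) (z : ℂ) : ℂ :=
  ∫ x, φ x * Complex.exp (-2 * Real.pi * Complex.I * z * t x) ∂μ

theorem norm_cexp_neg_two_pi_mul (z : ℂ) (s : ℝ) :
    ‖Complex.exp (-2 * Real.pi * Complex.I * z * s)‖ = Real.exp (2 * Real.pi * z.im * s) := by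
  rw [Complex.norm_exp]
  congr 1
  simp

variable {μ : Measure X} {φ : X → ℂ} {t : X → ℝ} {a b : ℝ} {m n : ℕ}

theorem norm_complexFourier_le (ha : 0 < a) (hb : 0 < b) (hab : a * b = 1)
    (hφ : Integrable (fun x => ‖φ x‖ * (Real.exp (Real.pi * a * |t x| ^ 2) / (1 + |t x|) ^ m)) μ) :
    ∃ C : ℝ, ∀ z : ℂ, ‖complexFourier μ φ t z‖ ≤
      C * (1 + |z.im|) ^ m * Real.exp (Real.pi * b * z.im ^ 2) := by
  obtain ⟨D, hD0, hD⟩ := exists_exp_mul_le_gaussian_weight ha hb hab m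
  refine ⟨(∫ x, ‖φ x‖ * (Real.exp (Real.pi * a * |t x| ^ 2) / (1 + |t x|) ^ m) ∂μ) * D,
    fun z => ?_⟩
  rw [mul_assoc, mul_assoc, ← integral_mul_const]
  refine norm_integral_le_of_norm_le (hφ.mul_const _) (Filter.Eventually.of_forall fun x => ?_)
  rw [norm_mul, norm_cexp_neg_two_pi_mul, mul_assoc ‖φ x‖]
  refine mul_le_mul_of_nonneg_left ?_ (norm_nonneg _)
  refine (hD _ _).trans ?_
  refine mul_le_mul_of_nonneg_left ?_ (by positivity)
  refine mul_le_of_le_one_right (by positivity) (Real.exp_le_one_iff.2 ?_)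
  have : 0 ≤ Real.pi * a / 2 * (t x - b * z.im) ^ 2 := by positivity
  linarith

theorem differentiable_complexFourier (ha : 0 < a) (hb : 0 < b) (hab : a * b = 1)
    (hφm : AEStronglyMeasurable φ μ) (ht : Measurable t)
    (hφ : Integrable (fun x => ‖φ x‖ * (Real.exp (Real.pi * a * |t x| ^ 2) / (1 + |t x|) ^ m)) μ) :
    Differentiable ℂ (complexFourier μ φ t) := by
  obtain ⟨D, hD0, hD⟩ := exists_exp_mul_le_gaussian_weight ha hb hab m
  have hexp : ∀ R : ℝ, Integrable (fun x => ‖φ x‖ * Real.exp (2 * Real.pi * R * |t x|)) μ := by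
    intro R
    refine Integrable.mono' (hφ.mul_const (D * ((1 + |R|) ^ m * Real.exp (Real.pi * b * R ^ 2))))
      (by fun_prop) (Filter.Eventually.of_forall fun x => ?_)
    rw [Real.norm_of_nonneg (by positivity), mul_assoc ‖φ x‖]
    refine mul_le_mul_of_nonneg_left ?_ (norm_nonneg _)
    refine (hD R |t x|).trans ?_
    rw [abs_abs]
    refine mul_le_mul_of_nonneg_left ?_ (by positivity)
    refine mul_le_of_le_one_right (by positivity) (Real.exp_le_one_iff.2 ?_)
    have : 0 ≤ Real.pi * a / 2 * (|t x| - b * R) ^ 2 := by positivity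
    linarith
  have hmeas : ∀ z : ℂ, AEStronglyMeasurable
      (fun x => φ x * Complex.exp (-2 * Real.pi * Complex.I * z * t x)) μ := fun z => by
    fun_prop
  have hbd : ∀ (z : ℂ) (x : X) (R : ℝ), |z.im| ≤ R →
      ‖φ x * Complex.exp (-2 * Real.pi * Complex.I * z * t x)‖ ≤
        ‖φ x‖ * Real.exp (2 * Real.pi * R * |t x|) := fun z x R hR => by
    rw [norm_mul, norm_cexp_neg_two_pi_mul]
    gcongr ‖φ x‖ * Real.exp ?_
    have : z.im * t x ≤ R * |t x| := by
      refine (le_abs_self _).trans ?_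
      rw [abs_mul]
      gcongr
    nlinarith [Real.pi_pos]
  intro z
  refine (hasDerivAt_integral_of_dominated_loc_of_deriv_le (μ := μ)
    (F := fun w x => φ x * Complex.exp (-2 * Real.pi * Complex.I * w * t x))
    (F' := fun w x => φ x * (Complex.exp (-2 * Real.pi * Complex.I * w * t x) *
      (-2 * Real.pi * Complex.I * t x)))
    -- In `|z.im| + 2`, one unit pays for the radius of the ball, the other for the factor `2π|t x|`
    -- from differentiation.
    (bound := fun x => ‖φ x‖ * Real.exp (2 * Real.pi * (|z.im| + 2) * |t x|))
    (Metric.ball_mem_nhds z one_pos) ?_ ?_ ?_ ?_ (hexp _) ?_).2.differentiableAt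
  · exact Filter.Eventually.of_forall hmeas
  · refine (hexp |z.im|).mono' (hmeas z) (Filter.Eventually.of_forall fun x => ?_)
    exact hbd z x _ le_rfl
  · fun_prop
  · refine Filter.Eventually.of_forall fun x w hw => ?_
    have hw' : |w.im| ≤ |z.im| + 1 := by
      have h1 : |(w - z).im| ≤ 1 := (Complex.abs_im_le_norm _).trans
        (by rw [← dist_eq_norm]; exact (Metric.mem_ball.1 hw).le)
      have h2 := abs_add_le (w - z).im z.im
      simp only [Complex.sub_im, sub_add_cancel] at h1 h2
      linarith
    rw [← mul_assoc, norm_mul]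
    have h3 : ‖(-2 * Real.pi * Complex.I * t x : ℂ)‖ ≤ Real.exp (2 * Real.pi * |t x|) := by
      have : ‖(-2 * Real.pi * Complex.I * t x : ℂ)‖ = 2 * Real.pi * |t x| := by
        simp [abs_of_pos Real.pi_pos]
      rw [this]
      linarith [Real.add_one_le_exp (2 * Real.pi * |t x|)]
    calc _ ≤ ‖φ x‖ * Real.exp (2 * Real.pi * (|z.im| + 1) * |t x|) *
          Real.exp (2 * Real.pi * |t x|) :=
        mul_le_mul (hbd w x _ hw') h3 (norm_nonneg _) (by positivity)
      _ = _ := by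
        rw [mul_assoc, ← Real.exp_add]
        congr 2
        ring
  · refine Filter.Eventually.of_forall fun x w _ => ?_
    refine HasDerivAt.const_mul _ (HasDerivAt.cexp ?_)
    simpa using ((hasDerivAt_id w).const_mul (-2 * Real.pi * Complex.I : ℂ)).mul_const (t x : ℂ)

/-- By Tonelli: the remaining Gaussian in `t x - b * τ` has an integral over `τ` that does not
depend on `x`. -/
theorem integrable_complexFourier_mul_I [SFinite μ] (ha : 0 < a) (hb : 0 < b) (hab : a * b = 1)
    (hφm : AEStronglyMeasurable φ μ) (ht : Measurable t)
    (hφ : Integrable (fun x => ‖φ x‖ * (Real.exp (Real.pi * a * |t x| ^ 2) / (1 + |t x|) ^ m)) μ) :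
    Integrable fun τ : ℝ => ‖complexFourier μ φ t (τ * Complex.I)‖ *
      Real.exp (-(Real.pi * b * τ ^ 2)) / (1 + |τ|) ^ m := by
  obtain ⟨D, hD0, hD⟩ := exists_exp_mul_le_gaussian_weight ha hb hab m
  have hd := (differentiable_complexFourier ha hb hab hφm ht hφ).continuous
  set g := fun x => ‖φ x‖ * (Real.exp (Real.pi * a * |t x| ^ 2) / (1 + |t x|) ^ m) with hg
  have hg0 : ∀ x, 0 ≤ g x := fun x => by positivity
  set c := Real.pi * a / 2
  have hc0 : 0 < c := by positivity
  have hgauss : ∀ s : ℝ, Integrable fun τ : ℝ => Real.exp (-c * (s - b * τ) ^ 2) := fun s =>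
    (((integrable_exp_neg_mul_sq hc0).comp_sub_left s).comp_mul_left' hb.ne')
  have hval : ∀ s : ℝ, ∫ τ : ℝ, Real.exp (-c * (s - b * τ) ^ 2) =
      |b⁻¹| * ∫ u : ℝ, Real.exp (-c * u ^ 2) := fun s => by
    have h1 := Measure.integral_comp_mul_left (fun u : ℝ => Real.exp (-c * (s - u) ^ 2)) b
    rw [h1, integral_sub_left_eq_self (fun u : ℝ => Real.exp (-c * u ^ 2))]
    rfl
  have hprod : Integrable (fun p : X × ℝ => g p.1 * Real.exp (-c * (t p.1 - b * p.2) ^ 2))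
      (μ.prod volume) := by
    refine (integrable_prod_iff ?_).2 ⟨?_, ?_⟩
    · refine (hφ.aestronglyMeasurable.comp_fst).mul ?_
      exact Measurable.aestronglyMeasurable (by fun_prop)
    · exact Filter.Eventually.of_forall fun x => (hgauss (t x)).const_mul (g x)
    · have : (fun x => ∫ τ : ℝ, ‖g x * Real.exp (-c * (t x - b * τ) ^ 2)‖) =
          fun x => g x * (|b⁻¹| * ∫ u : ℝ, Real.exp (-c * u ^ 2)) := by
        funext x
        rw [← hval (t x), ← integral_const_mul]
        refine integral_congr_ae (Filter.Eventually.of_forall fun τ => ?_)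
        exact Real.norm_of_nonneg (mul_nonneg (hg0 x) (Real.exp_nonneg _))
      rw [this]
      exact hφ.mul_const _
  refine Integrable.mono' (hprod.integral_prod_right.const_mul D) ?_ ?_
  · refine Continuous.aestronglyMeasurable ?_
    refine Continuous.div (by fun_prop) (by fun_prop) fun τ => by positivity
  · filter_upwards [hprod.prod_left_ae] with τ hτ
    rw [Real.norm_of_nonneg (by positivity), div_le_iff₀ (by positivity), Real.exp_neg,
      ← div_eq_mul_inv, div_le_iff₀ (Real.exp_pos _), ← integral_const_mul, mul_assoc,
      ← integral_mul_const]
    refine norm_integral_le_of_norm_le ((hτ.const_mul D).mul_const _)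
      (Filter.Eventually.of_forall fun x => ?_)
    rw [norm_mul, norm_cexp_neg_two_pi_mul]
    have := hD τ (t x)
    simp only [Complex.im_ofReal_mul, Complex.I_im, mul_one]
    calc _ ≤ _ := mul_le_mul_of_nonneg_left this (norm_nonneg _)
      _ = _ := by rw [hg]; ring

theorem complexFourier_eq_zero [SFinite μ] (ha : 0 < a) (hb : 0 < b) (hab : a * b = 1)
    (hφm : AEStronglyMeasurable φ μ) (ht : Measurable t)
    (hφ : Integrable (fun x => ‖φ x‖ * (Real.exp (Real.pi * a * |t x| ^ 2) / (1 + |t x|) ^ m)) μ)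
    (hr : Integrable fun s : ℝ => ‖complexFourier μ φ t s‖ *
      (Real.exp (Real.pi * b * |s| ^ 2) / (1 + |s|) ^ n))
    (hmn : m = 1 ∨ n = 1) (z : ℂ) : complexFourier μ φ t z = 0 := by
  have hd := differentiable_complexFourier ha hb hab hφm ht hφ
  obtain ⟨C, hC⟩ := norm_complexFourier_le ha hb hab hφ
  have hnorm : ∀ w : ℂ, ‖Complex.exp (Real.pi * b * w ^ 2)‖ =
      Real.exp (Real.pi * b * w.re ^ 2) * Real.exp (-(Real.pi * b * w.im ^ 2)) := fun w => by
    rw [Complex.norm_exp, ← Real.exp_add]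
    congr 1
    have : (Real.pi * b * w ^ 2 : ℂ) = ((Real.pi * b : ℝ) : ℂ) * w ^ 2 := by push_cast; ring
    rw [this, Complex.re_ofReal_mul]
    simp [pow_two]
    ring
  have := eq_zero_of_integrable_on_axes (β := Real.pi * b) (m := m) (n := n) (C := C)
    (H := fun w => complexFourier μ φ t w * Complex.exp (Real.pi * b * w ^ 2))
    (hd.mul (by fun_prop)) (by positivity) (fun w => ?_) ?_ ?_ hmn z
  · simpa using this
  · rw [norm_mul, hnorm]
    refine (mul_le_mul_of_nonneg_right (hC w) (by positivity)).trans_eq ?_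
    rw [Real.exp_neg]
    field_simp
  · refine hr.congr (Filter.Eventually.of_forall fun s => ?_)
    simp only [norm_mul, hnorm]
    simp [mul_div_assoc]
  · refine (integrable_complexFourier_mul_I ha hb hab hφm ht hφ).congr
      (Filter.Eventually.of_forall fun s => ?_)
    simp only [norm_mul, hnorm]
    simp

end LaplaceIntegral

/-! ### Compatibility of the two Fourier transforms -/

/-- On `L¹ ∩ L²` the `L²` Fourier transform is given by the Fourier integral. -/
theorem MeasureTheory.Lp.coeFn_fourier_of_integrable {V : Type*} [NormedAddCommGroup V]
    [InnerProductSpace ℝ V] [FiniteDimensional ℝ V] [MeasurableSpace V] [BorelSpace V]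
    (f : Lp (α := V) ℂ 2 volume) (hf : Integrable f volume) :
    ((𝓕 f : Lp (α := V) ℂ 2 volume) : V → ℂ) =ᵐ[volume] 𝓕 (f : V → ℂ) := by
  have hcont : Continuous (𝓕 (f : V → ℂ)) :=
    VectorFourier.fourierIntegral_continuous Real.continuous_fourierChar
      (L := innerₗ V) continuous_inner hf
  have hloc := (Lp.memLp (𝓕 f : Lp (α := V) ℂ 2 volume)).locallyIntegrable (by norm_num)
  have hsub : ∀ᵐ x : V, (𝓕 f : Lp (α := V) ℂ 2 volume) x - 𝓕 (f : V → ℂ) x = 0 := by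
    refine ae_eq_zero_of_integral_contDiff_smul_eq_zero
      (hloc.sub hcont.locallyIntegrable) fun g g_smooth g_cpt => ?_
    have hg₁ : HasCompactSupport (Complex.ofRealCLM ∘ g) := g_cpt.comp_left rfl
    have hg₂ : ContDiff ℝ (⊤ : ℕ∞) (Complex.ofRealCLM ∘ g) := by fun_prop
    set φ : SchwartzMap V ℂ := hg₁.toSchwartzMap hg₂ with hφ
    have hφg : ∀ x, φ x = (g x : ℂ) := fun x => by simp [hφ]
    -- Both transforms move onto the test function: the `L²` one as a tempered distribution, the
    -- integral one by Fubini.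
    have h1 : ∫ x, φ x • (𝓕 f : Lp (α := V) ℂ 2 volume) x = ∫ x, (𝓕 φ) x • f x := by
      have := DFunLike.congr_fun (Lp.fourier_toTemperedDistribution_eq f) φ
      rw [TemperedDistribution.fourier_apply, Lp.toTemperedDistribution_apply,
        Lp.toTemperedDistribution_apply] at this
      exact this.symm
    have h2 : ∫ x, (𝓕 φ) x • f x = ∫ x, φ x • 𝓕 (f : V → ℂ) x := by
      simpa using! VectorFourier.integral_fourierIntegral_smul_eq_flip (L := innerₗ V)
        Real.continuous_fourierChar continuous_inner φ.integrable hf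
    have h3 : ∀ F : V → ℂ, ∀ x, g x • F x = φ x • F x := fun F x => by
      rw [hφg]; simp
    simp only [smul_sub]
    rw [integral_sub]
    · simp only [h3]
      rw [h1, h2, sub_self]
    · exact hloc.integrable_smul_left_of_hasCompactSupport g_smooth.continuous g_cpt
    · exact hcont.locallyIntegrable.integrable_smul_left_of_hasCompactSupport
        g_smooth.continuous g_cpt
  filter_upwards [hsub] with x hx using sub_eq_zero.1 hx

/-! ### Reduction to one frequency variable -/

theorem integrable_mul_exp_div_pow_of_rpow {X : Type*} [MeasurableSpace X] {μ : Measure X}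
    {φ : X → ℂ} {t : X → ℝ} {a M : ℝ} (hφm : AEStronglyMeasurable φ μ) (ht : Measurable t)
    (h : Integrable (fun x => ‖φ x‖ * (Real.exp (Real.pi * a * |t x| ^ 2) / (1 + |t x|) ^ M)) μ) :
    Integrable (fun x =>
      ‖φ x‖ * (Real.exp (Real.pi * a * |t x| ^ 2) / (1 + |t x|) ^ ⌈M⌉₊)) μ := by
  refine h.mono' (hφm.norm.mul (Measurable.aestronglyMeasurable (by fun_prop)))
    (Filter.Eventually.of_forall fun x => ?_)
  rw [Real.norm_of_nonneg (by positivity), ← Real.rpow_natCast _ ⌈M⌉₊]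
  gcongr
  · linarith [abs_nonneg (t x)]
  · exact Nat.le_ceil M

/-- The coordinates of `ℝᵏ⁺¹` split into the `j`-th one and the others. -/
noncomputable def euclideanInsertNth {k : ℕ} (j : Fin (k + 1)) :
    ℝ × (Fin k → ℝ) ≃ᵐ EuclideanSpace ℝ (Fin (k + 1)) :=
  (MeasurableEquiv.piFinSuccAbove (fun _ => ℝ) j).symm.trans (MeasurableEquiv.toLp 2 _)

theorem measurePreserving_euclideanInsertNth {k : ℕ} (j : Fin (k + 1)) :
    MeasurePreserving (euclideanInsertNth j) (volume.prod volume) volume :=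
  (PiLp.volume_preserving_toLp (Fin (k + 1))).comp
    ((volume_preserving_piFinSuccAbove (fun _ : Fin (k + 1) => ℝ) j).symm _)

theorem euclideanInsertNth_apply {k : ℕ} (j : Fin (k + 1)) (p : ℝ × (Fin k → ℝ)) :
    euclideanInsertNth j p = WithLp.toLp 2 (j.insertNth p.1 p.2) := rfl

/-- The other frequencies enter only through a unimodular phase, so the weighted integrability of
`f` survives without slicing `f` in space. -/
theorem complexFourier_eq_fourier {k : ℕ} (j : Fin (k + 1))
    (f : EuclideanSpace ℝ (Fin (k + 1)) → ℂ) (y : Fin k → ℝ) (s : ℝ) :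
    complexFourier volume (fun x : EuclideanSpace ℝ (Fin (k + 1)) =>
      f x * Complex.exp ((-2 * Real.pi * ∑ i, x (j.succAbove i) * y i : ℝ) * Complex.I))
      (fun x => x j) s = 𝓕 f (euclideanInsertNth j (s, y)) := by
  rw [Real.fourier_eq', complexFourier]
  congr 1
  funext x
  have h1 : inner ℝ x (euclideanInsertNth j (s, y)) =
      x j * s + ∑ i, x (j.succAbove i) * y i := by
    rw [euclideanInsertNth_apply, PiLp.inner_apply, Fin.sum_univ_succAbove _ j]
    simp [mul_comm]
  rw [h1, mul_assoc, ← Complex.exp_add, smul_eq_mul, mul_comm]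
  congr 2
  push_cast
  ring

theorem mainTheorem12 (d : ℕ) (f : Lp (α := EuclideanSpace ℝ (Fin d)) ℂ 2 volume)
    (a b M N : ℝ) (ha : 0 < a) (hb : 0 < b) (hab : a * b = 1) (hMN : min M N = 1) (j : Fin d)
    (hf : Integrable (fun x : EuclideanSpace ℝ (Fin d) =>
      ‖f x‖ * (Real.exp (Real.pi * a * |x j| ^ 2) / (1 + |x j|) ^ M)) volume)
    (hfhat : Integrable (fun y : EuclideanSpace ℝ (Fin d) =>
      ‖(𝓕 f : Lp (α := EuclideanSpace ℝ (Fin d)) ℂ 2 volume) y‖ *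
        (Real.exp (Real.pi * b * |y j| ^ 2) / (1 + |y j|) ^ N)) volume) :
    f = 0 := by
  obtain ⟨k, rfl⟩ : ∃ k, d = k + 1 := ⟨d - 1, by have := j.pos; omega⟩
  have hcoord : Measurable fun x : EuclideanSpace ℝ (Fin (k + 1)) => x j := by fun_prop
  have hfm := (Lp.memLp f).aestronglyMeasurable
  have hf' := integrable_mul_exp_div_pow_of_rpow hfm hcoord hf
  have hfhat' := integrable_mul_exp_div_pow_of_rpow
    (Lp.memLp (𝓕 f : Lp (α := EuclideanSpace ℝ (Fin (k + 1))) ℂ 2 volume)).aestronglyMeasurable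
    hcoord hfhat
  -- Rounding up is harmless: the exponent equal to 1 is unchanged, and the other may be any natural
  -- number.
  have hmn : ⌈M⌉₊ = 1 ∨ ⌈N⌉₊ = 1 := by
    rcases min_choice M N with h | h <;> rw [hMN] at h
    · left; simp [← h]
    · right; simp [← h]
  have hfi : Integrable f volume := by
    -- At frequency `τ = 0` the kernel estimate bounds 1 by a multiple of the weight.
    obtain ⟨D, hD0, hD⟩ := exists_exp_mul_le_gaussian_weight ha hb hab ⌈M⌉₊
    refine Integrable.mono' (hf'.mul_const D) hfm (Filter.Eventually.of_forall fun x => ?_)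
    rw [mul_assoc]
    refine le_mul_of_one_le_right (norm_nonneg _) ?_
    have := hD 0 (x j)
    simp only [mul_zero, zero_mul, Real.exp_zero, abs_zero, add_zero, one_pow, sub_zero, mul_one,
      ne_eq, OfNat.ofNat_ne_zero, not_false_eq_true, zero_pow] at this
    refine this.trans ?_
    gcongr
    refine mul_le_of_le_one_right hD0 (Real.exp_le_one_iff.2 ?_)
    have : 0 ≤ Real.pi * a / 2 * x j ^ 2 := by positivity
    linarith
  have hF := Lp.coeFn_fourier_of_integrable f hfi
  have hFint := hfhat'.congr (hF.mono fun y hy => by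
    simp only [hy]; exact rfl)
  have hslice : ∀ᵐ y : Fin k → ℝ, ∀ s : ℝ,
      𝓕 (f : EuclideanSpace ℝ (Fin (k + 1)) → ℂ) (euclideanInsertNth j (s, y)) = 0 := by
    have h1 := ((measurePreserving_euclideanInsertNth j).integrable_comp_of_integrable
      hFint).prod_left_ae
    filter_upwards [h1] with y hy s
    rw [← complexFourier_eq_fourier]
    refine complexFourier_eq_zero (m := ⌈M⌉₊) (n := ⌈N⌉₊) ha hb hab
      (hfm.fun_mul (Continuous.aestronglyMeasurable (by fun_prop))) hcoord ?_ ?_ hmn _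
    · simpa only [norm_mul, Complex.norm_exp_ofReal_mul_I, mul_one] using hf'
    · simp only [complexFourier_eq_fourier]
      simpa [euclideanInsertNth_apply, Function.comp_def] using hy
  have hzero : ∀ᵐ x, 𝓕 (f : EuclideanSpace ℝ (Fin (k + 1)) → ℂ) x = 0 := by
    have h1 : ∀ᵐ p : ℝ × (Fin k → ℝ) ∂(volume.prod volume), ∀ s : ℝ,
        𝓕 (f : EuclideanSpace ℝ (Fin (k + 1)) → ℂ) (euclideanInsertNth j (s, p.2)) = 0 :=
      Measure.quasiMeasurePreserving_snd.ae hslice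
    have h2 := ((measurePreserving_euclideanInsertNth j).symm _).quasiMeasurePreserving.ae h1
    filter_upwards [h2] with x hx
    simpa using hx ((euclideanInsertNth j).symm x).1
  have hfourier : (𝓕 f : Lp (α := EuclideanSpace ℝ (Fin (k + 1))) ℂ 2 volume) = 0 := by
    rw [Lp.eq_zero_iff_ae_eq_zero]
    filter_upwards [hF, hzero] with x hx hx'
    rw [hx, hx']
    rfl
  rw [← norm_eq_zero, ← Lp.norm_fourier_eq, hfourier, norm_zero]
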